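/- Let $G$ be a finite group acting on a compact polyhedron $P$ (a subset of a finite-dimensional real normed space which is the underlying space of some finite geometric simplicial complex), and let $G$ act linearly on a finite-dimensional real vector space $V$. Write $P^H$ and $V^H$ for the sets of points fixed by a subgroup $H \subseteq G$, and assume that $\dim P^H \le \dim V^H$ for every subgroup $H \subseteq G$ (where $\dim P^H$ is the largest dimension of a straight simplex contained in $P^H$, and $\dim\emptyset = -\infty$). Let $K$ be any $G$-invariant triangulation of $P$, that is, a finite geometric simplicial complex with underlying space $P$ such that every $g \in G$ maps every simplex of $K$ affinely onto a simplex of $K$. Let $K''$ be the second barycentric subdivision of $K$, and let $\mathcal M$ be the set of all continuous $G$-equivariant maps $f : P \to V$ that are affine on every simplex of $K''$, with the topology of uniform convergence. Then there is an open dense subset $\mathcal U \subseteq \mathcal M$ such that for every $f \in \mathcal U$ and every $y \in V$ the fiber $f^{-1}(y)$ is finite. -/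

import Mathlib

open Geometry

noncomputable section

namespace EquivariantPL

variable {E : Type*} [NormedAddCommGroup E] [NormedSpace ℝ E]

/-- The barycenter of the simplex with vertex set `s`. -/
def barycenter (s : Finset E) : E := s.centroid ℝ id

/-- The vertex sets of the simplices of the barycentric subdivision of a family `F` of simplices
(each given by its vertex set): for every nonempty finite chain `σ₀ ⊂ σ₁ ⊂ ⋯ ⊂ σₖ` of members
of `F`, there is one simplex, with vertices the barycenters of `σ₀, …, σₖ`. -/
def barycentricSubdivision (F : Set (Finset E)) : Set (Finset E) :=
  {t | ∃ c : Finset (Finset E), c.Nonempty ∧ (c : Set (Finset E)) ⊆ F ∧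
    IsChain (· ⊆ ·) (c : Set (Finset E)) ∧
    (t : Set E) = barycenter '' (c : Set (Finset E))}

/-- The second barycentric subdivision. -/
def secondBarycentricSubdivision (F : Set (Finset E)) : Set (Finset E) :=
  barycentricSubdivision (barycentricSubdivision F)

/-- The dimension of a subset `A` of `E` that is a polyhedron: the largest dimension of a
(nondegenerate, straight) simplex contained in `A`, and `⊥` if `A` is empty. -/
def polyhedralDim (A : Set E) : WithBot ℕ∞ :=
  ⨆ s ∈ {s : Finset E | s.Nonempty ∧ AffineIndependent ℝ ((↑) : s → E) ∧
      convexHull ℝ (s : Set E) ⊆ A},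
    (((s.card - 1 : ℕ) : ℕ∞) : WithBot ℕ∞)

/-- The finite geometric simplicial complex `K` is a triangulation of `P`. A set `P` that has such
a triangulation is a (compact) polyhedron. -/
structure IsTriangulation (K : SimplicialComplex ℝ E) (P : Set E) : Prop where
  finite_faces : K.faces.Finite
  space_eq : K.space = P

/-- `f` is linear on the faces in `F`: on every simplex of `F` it agrees with an affine map. -/
def IsLinearOnFaces {W : Type*} [AddCommGroup W] [Module ℝ W] {P : Set E}
    (F : Set (Finset E)) (f : P → W) : Prop :=
  ∀ s ∈ F, ∃ A : E →ᵃ[ℝ] W, ∀ x : P, (x : E) ∈ convexHull ℝ (s : Set E) → f x = A x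

/-- The triangulation `K` of `P` is `G`-invariant: every `g : G` maps every simplex of `K`
onto a simplex of `K`, and does so linearly. -/
structure IsInvariantTriangulation (G : Type*) [Group G] (K : SimplicialComplex ℝ E) (P : Set E)
    [MulAction G P] : Prop extends IsTriangulation K P where
  map_face : ∀ g : G, ∀ s ∈ K.faces, ∃ t ∈ K.faces,
    (fun x : P => ((g • x : P) : E)) '' {x : P | (x : E) ∈ convexHull ℝ (s : Set E)} =
      convexHull ℝ (t : Set E)
  linear : ∀ g : G, IsLinearOnFaces K.faces (fun x : P => ((g • x : P) : E))

/-- The space of `G`-equivariant maps `P → V` that are linear on the faces in `F`, a subspace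
of the space of continuous maps with the compact-open topology (for compact `P`, this is the
topology of uniform convergence). -/
def equivariantMaps {G : Type*} [Group G] {V : Type*} [NormedAddCommGroup V] [NormedSpace ℝ V]
    (ρ : Representation ℝ G V) (P : Set E) [MulAction G P] (F : Set (Finset E)) :
    Set C(P, V) :=
  {f | (∀ (g : G) (x : P), f (g • x) = ρ g (f x)) ∧ IsLinearOnFaces F (f : P → V)}

end EquivariantPL

end

/-!
An equivariant map which is affine on the simplices of the second barycentric subdivision `K''` has
finite fibers as soon as it is injective on every simplex of `K''`, since there are finitely many
simplices. On a simplex `s` this means that the images of its vertices are affinely independent,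
that is, that the vectors `(f v, 1)`, `v ∈ s`, of `V × ℝ` are linearly independent. The set `U`
consists of the `f` with this property for all `s`.

For each `s` the condition is open. It is dense as soon as a single map `h` satisfies it: on the
line joining a map `f` to `h`, independence fails only at roots of a nonzero determinant, a
polynomial in the parameter (`finite_setOf_not_linearIndependent_segment`), and the equivariant
piecewise affine maps are closed under affine combinations. A finite intersection of dense open
sets is dense, so it remains to find `h` for a given simplex `s` of `K''`
(`exists_equivariant_linearIndepOn`, `exists_equivariant_extension`).

The vertices `v₀, …, vₖ` of `s` are the barycenters of a chain `σ₀ ⊂ ⋯ ⊂ σₖ` of simplices of the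
first subdivision `K'`. Two vertices of a simplex of a barycentric subdivision which lie in one
orbit are equal, because they are barycenters of simplices of equal dimension in a chain
(`IsSimplicialAction.smul_eq_of_mem_subdivision`). Applied to `K''`, this shows that the values of
an equivariant map at `v₀, …, vₖ` can be prescribed independently of each other, the value at `vⱼ`
being any vector fixed by the stabilizer of `vⱼ`. Applied to `K'`, it shows that an element which
preserves `σⱼ` fixes `σⱼ` pointwise, so that the stabilizers `G₀ ⊇ ⋯ ⊇ Gₖ` decrease
(`IsSimplicialAction.smul_barycenter_eq_of_subset`). Hence the simplex with vertices `v₀, …, vⱼ` is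
fixed by `Gⱼ`, the assumption on dimensions gives `j ≤ dim V^{Gⱼ}`, and as the subspaces `V^{Gⱼ}`
increase, the values can be chosen one after the other, each outside the affine span of the
preceding ones (`exists_linearIndepOn_of_card_le_finrank`).

That vertex values extend to a continuous map needs that the subdivision of a simplicial complex is
a simplicial complex with the same underlying space (`subdivision`, `subdivision_space`). A point
in a simplex of the subdivision determines its vertex weights with respect to `K`; these determine
the weights of the barycenters, because the simplices of positive weight in the chain are
superlevel sets of the vertex weights (`chain_weights_unique`).
-/

noncomputable section

namespace EquivariantPL

open scoped Classical Pointwise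

/-! ### Linear algebra -/

section LinearAlgebra

variable {ι V W : Type*} [AddCommGroup V] [Module ℝ V] [AddCommGroup W] [Module ℝ W]

theorem affineIndependent_iff_linearIndependent_prodMk {p : ι → V} :
    AffineIndependent ℝ p ↔ LinearIndependent ℝ (fun i => (p i, (1 : ℝ))) := by
  rw [affineIndependent_iff, linearIndependent_iff']
  refine forall₂_congr fun s w => ?_
  simp only [Prod.ext_iff, Prod.fst_sum, Prod.snd_sum, Prod.smul_fst, Prod.smul_snd,
    Prod.fst_zero, Prod.snd_zero, smul_eq_mul, mul_one]
  tauto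

theorem affineIndependent_coe_iff {s : Finset V} :
    AffineIndependent ℝ ((↑) : s → V) ↔
      LinearIndepOn ℝ (fun v : V => (v, (1 : ℝ))) (s : Set V) :=
  affineIndependent_iff_linearIndependent_prodMk

theorem linearIndepOn_prodMk_iff {s : Finset ι} {p : ι → V} :
    LinearIndepOn ℝ (fun i => (p i, (1 : ℝ))) (s : Set ι) ↔
      ∀ d : ι → ℝ, ∑ i ∈ s, d i • p i = 0 → ∑ i ∈ s, d i = 0 → ∀ i ∈ s, d i = 0 := by
  rw [linearIndepOn_finset_iff]
  refine forall_congr' fun w => ?_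
  simp only [Prod.ext_iff, Prod.fst_sum, Prod.snd_sum, Prod.smul_fst, Prod.smul_snd,
    Prod.fst_zero, Prod.snd_zero, smul_eq_mul, mul_one]
  tauto

/-- Linear independence is generic on the line joining any family to an independent one: it holds
wherever a certain determinant, a polynomial in `t` with value `1` at `t = 1`, does not vanish. -/
theorem finite_setOf_not_linearIndependent_segment [Finite ι] (a : ι → W) {b : ι → W}
    (hb : LinearIndependent ℝ b) :
    {t : ℝ | ¬ LinearIndependent ℝ (fun i => (1 - t) • a i + t • b i)}.Finite := by
  have := Fintype.ofFinite ι
  obtain ⟨φ, hφ⟩ := LinearMap.exists_leftInverse_of_injective (Fintype.linearCombination ℝ b)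
    (LinearMap.ker_eq_bot.2 hb.fintypeLinearCombination_injective)
  have hφb : ∀ i, φ (b i) = Pi.single i 1 := fun i => by
    have := LinearMap.congr_fun hφ (Pi.single i 1)
    simpa [Fintype.linearCombination_apply_single] using this
  let A : Matrix ι ι ℝ := fun i j => φ (a i) j
  let N : Matrix ι ι (Polynomial ℝ) :=
    (1 - Polynomial.X : Polynomial ℝ) • A.map Polynomial.C + (Polynomial.X : Polynomial ℝ) • 1
  have hN : ∀ t : ℝ, N.det.eval t = ((1 - t) • A + t • (1 : Matrix ι ι ℝ)).det := fun t => by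
    rw [← Polynomial.coe_evalRingHom, RingHom.map_det]
    congr 1
    ext i j
    by_cases hij : i = j <;> simp [N, hij]
  have hN0 : N.det ≠ 0 := fun h => by
    have := hN 1
    simp [h] at this
  refine (Polynomial.finite_setOfPred_isRoot hN0).subset fun t ht => ?_
  by_contra hdet
  refine ht (LinearIndependent.of_comp φ ?_)
  have hdet' : ((1 - t) • A + t • (1 : Matrix ι ι ℝ)).det ≠ 0 := by rwa [← hN]
  convert! Matrix.linearIndependent_rows_of_det_ne_zero hdet' using 1
  ext i j
  simp [hφb, A, Matrix.one_apply, Pi.single_apply, eq_comm]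
  rfl

/-- An affine map can be prescribed freely on an affinely independent family. -/
theorem exists_affineMap_apply_eq [Finite ι] {p : ι → V}
    (hp : LinearIndependent ℝ fun i => (p i, (1 : ℝ))) (φ : ι → W) :
    ∃ A : V →ᵃ[ℝ] W, ∀ i, A (p i) = φ i := by
  have := Fintype.ofFinite ι
  obtain ⟨ψ, hψ⟩ := LinearMap.exists_leftInverse_of_injective
    (Fintype.linearCombination ℝ fun i => (p i, (1 : ℝ)))
    (LinearMap.ker_eq_bot.2 hp.fintypeLinearCombination_injective)
  let L : V × ℝ →ₗ[ℝ] W := Fintype.linearCombination ℝ φ ∘ₗ ψ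
  refine ⟨(L.comp (LinearMap.inl ℝ V ℝ)).toAffineMap + AffineMap.const ℝ V (L (0, 1)),
    fun i => ?_⟩
  have h1 := LinearMap.congr_fun hψ (Pi.single i 1)
  have h2 : ψ (p i, 1) = Pi.single i 1 := by
    simpa [Fintype.linearCombination_apply_single] using h1
  have h3 : L (p i, 1) = φ i := by
    simp [L, h2, Fintype.linearCombination_apply_single]
  rw [← h3]
  simp [← map_add]

end LinearAlgebra

/-! ### Weights on chains of finite sets -/

section Chains

variable {α : Type*} {c c' : Finset (Finset α)} {σ : Finset α}

/-- A nonempty set is not covered by the members of a finite chain strictly below it. -/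
theorem exists_mem_forall_ssubset_notMem (hc : IsChain (· ⊆ ·) (c : Set (Finset α)))
    (hσ : σ.Nonempty) : ∃ v ∈ σ, ∀ τ ∈ c, τ ⊂ σ → v ∉ τ := by
  rcases (c.filter (· ⊂ σ)).eq_empty_or_nonempty with h | h
  · obtain ⟨v, hv⟩ := hσ
    refine ⟨v, hv, fun τ hτ hτσ => ?_⟩
    have : τ ∈ c.filter (· ⊂ σ) := by simp [hτ, hτσ]
    simp [h] at this
  · obtain ⟨S, hS, hmax⟩ := Finset.exists_max_image _ Finset.card h
    rw [Finset.mem_filter] at hS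
    obtain ⟨v, hv, hvS⟩ := Finset.exists_of_ssubset hS.2
    refine ⟨v, hv, fun τ hτ hτσ hvτ => hvS ?_⟩
    have hle := hmax τ (by simp [hτ, hτσ])
    rcases hc.total hτ hS.1 with h1 | h1
    · exact h1 hvτ
    · exact Finset.eq_of_subset_of_card_le h1 hle ▸ hvτ

/-- The indicator functions of the members of a finite chain of nonempty sets are linearly
independent. -/
theorem eq_zero_of_sum_chain_eq_zero (hc : IsChain (· ⊆ ·) (c : Set (Finset α)))
    (hne : ∀ σ ∈ c, σ.Nonempty) {d : Finset α → ℝ}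
    (h : ∀ v, ∑ σ ∈ c with v ∈ σ, d σ = 0) : ∀ σ ∈ c, d σ = 0 := by
  by_contra! hcon
  obtain ⟨σ₀, hσ₀, hd₀⟩ := hcon
  obtain ⟨T, hT, hmax⟩ := Finset.exists_max_image (c.filter (d · ≠ 0)) Finset.card
    ⟨σ₀, by simp [hσ₀, hd₀]⟩
  rw [Finset.mem_filter] at hT
  obtain ⟨v, hv, hvT⟩ := exists_mem_forall_ssubset_notMem hc (hne T hT.1)
  refine hT.2 ?_
  rw [← h v, Finset.sum_eq_single T]
  · intro τ hτ hτT
    rw [Finset.mem_filter] at hτ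
    by_contra hdτ
    have hle := hmax τ (by simp [hτ.1, hdτ])
    rcases hc.total hτ.1 hT.1 with h1 | h1
    · exact hvT τ hτ.1 (h1.ssubset_of_ne hτT) hτ.2
    · exact hτT (Finset.eq_of_subset_of_card_le h1 hle).symm
  · simp [hT.1, hv]

/-- A member of positive weight in a chain is a superlevel set of the weighted sum of the indicator
functions of the chain. -/
theorem mem_iff_sum_chain_le (hc : IsChain (· ⊆ ·) (c : Set (Finset α))) {a : Finset α → ℝ}
    (ha : ∀ τ, 0 ≤ a τ) (hσ : σ ∈ c) (haσ : 0 < a σ) (v : α) :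
    v ∈ σ ↔ ∑ τ ∈ c with σ ⊆ τ, a τ ≤ ∑ τ ∈ c with v ∈ τ, a τ := by
  refine ⟨fun hv => ?_, fun hle => ?_⟩
  · refine Finset.sum_le_sum_of_subset_of_nonneg (fun τ hτ => ?_) fun τ _ _ => ha τ
    rw [Finset.mem_filter] at hτ ⊢
    exact ⟨hτ.1, hτ.2 hv⟩
  · by_contra hv
    refine hle.not_gt (Finset.sum_lt_sum_of_subset (i := σ) (fun τ hτ => ?_) ?_ ?_ haσ
      fun τ _ _ => ha τ)
    · rw [Finset.mem_filter] at hτ ⊢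
      exact ⟨hτ.1, (hc.total hσ hτ.1).resolve_right fun h => hv (h hτ.2)⟩
    · simp [hσ]
    · simp [hv]

/-- If two chains have the same weighted sum of indicator functions, their members of positive weight
form one chain, being superlevel sets of one function. -/
theorem isChain_union_of_sum_eq (hc : IsChain (· ⊆ ·) (c : Set (Finset α)))
    (hc' : IsChain (· ⊆ ·) (c' : Set (Finset α))) {a a' : Finset α → ℝ}
    (ha : ∀ τ, 0 ≤ a τ) (ha' : ∀ τ, 0 ≤ a' τ)
    (h : ∀ v, ∑ σ ∈ c with v ∈ σ, a σ = ∑ σ ∈ c' with v ∈ σ, a' σ) :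
    IsChain (· ⊆ ·)
      ((c.filter (0 < a ·) ∪ c'.filter (0 < a' ·) : Finset (Finset α)) : Set (Finset α)) := by
  set W : α → ℝ := fun v => ∑ σ ∈ c with v ∈ σ, a σ with hW
  have key : ∀ σ ∈ c.filter (0 < a ·) ∪ c'.filter (0 < a' ·),
      ∃ r : ℝ, ∀ v, v ∈ σ ↔ r ≤ W v := by
    intro σ hσ
    rw [Finset.mem_union, Finset.mem_filter, Finset.mem_filter] at hσ
    rcases hσ with hσ | hσ
    · exact ⟨_, fun v => mem_iff_sum_chain_le hc ha hσ.1 hσ.2 v⟩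
    · refine ⟨∑ τ ∈ c' with σ ⊆ τ, a' τ, fun v => ?_⟩
      simpa only [hW, h] using mem_iff_sum_chain_le hc' ha' hσ.1 hσ.2 v
  intro σ hσ τ hτ _
  obtain ⟨r, hr⟩ := key σ hσ
  obtain ⟨q, hq⟩ := key τ hτ
  rcases le_total r q with hrq | hrq
  · exact Or.inr fun v hv => (hr v).2 (hrq.trans ((hq v).1 hv))
  · exact Or.inl fun v hv => (hq v).2 (hrq.trans ((hr v).1 hv))

/-- A function is a combination of the indicators of a chain with nonnegative weights in at most one
way. -/
theorem chain_weights_unique (hc : IsChain (· ⊆ ·) (c : Set (Finset α)))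
    (hc' : IsChain (· ⊆ ·) (c' : Set (Finset α)))
    (hne : ∀ σ ∈ c, σ.Nonempty) (hne' : ∀ σ ∈ c', σ.Nonempty) {a a' : Finset α → ℝ}
    (ha : ∀ τ, 0 ≤ a τ) (ha' : ∀ τ, 0 ≤ a' τ)
    (ha0 : ∀ τ ∉ c, a τ = 0) (ha0' : ∀ τ ∉ c', a' τ = 0)
    (h : ∀ v, ∑ σ ∈ c with v ∈ σ, a σ = ∑ σ ∈ c' with v ∈ σ, a' σ) : a = a' := by
  set B := c.filter (0 < a ·) ∪ c'.filter (0 < a' ·) with hB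
  have memB : ∀ σ, σ ∈ B ↔ a σ ≠ 0 ∨ a' σ ≠ 0 := by
    intro σ
    have h1 := ha0 σ
    have h2 := ha0' σ
    have h3 := (ha σ).lt_iff_ne'
    have h4 := (ha' σ).lt_iff_ne'
    simp only [hB, Finset.mem_union, Finset.mem_filter, h3, h4]
    tauto
  have hsum : ∀ v, ∑ σ ∈ B with v ∈ σ, (a σ - a' σ) = 0 := by
    intro v
    have e1 : ∑ σ ∈ B with v ∈ σ, a σ = ∑ σ ∈ c with v ∈ σ, a σ := by
      simp only [Finset.sum_filter]
      refine Finset.sum_congr_of_eq_on_inter ?_ ?_ fun _ _ _ => rfl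
      · intro σ _ hσ
        simp [ha0 σ hσ]
      · intro σ _ hσ
        rw [memB] at hσ
        push Not at hσ
        simp [hσ.1]
    have e2 : ∑ σ ∈ B with v ∈ σ, a' σ = ∑ σ ∈ c' with v ∈ σ, a' σ := by
      simp only [Finset.sum_filter]
      refine Finset.sum_congr_of_eq_on_inter ?_ ?_ fun _ _ _ => rfl
      · intro σ _ hσ
        simp [ha0' σ hσ]
      · intro σ _ hσ
        rw [memB] at hσ
        push Not at hσ
        simp [hσ.2]
    rw [Finset.sum_sub_distrib, e1, e2, h, sub_self]
  have hneB : ∀ σ ∈ B, σ.Nonempty := by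
    intro σ hσ
    simp only [hB, Finset.mem_union, Finset.mem_filter] at hσ
    rcases hσ with hσ | hσ
    exacts [hne σ hσ.1, hne' σ hσ.1]
  have hz := eq_zero_of_sum_chain_eq_zero (isChain_union_of_sum_eq hc hc' ha ha' h) hneB hsum
  funext σ
  by_cases hσ : σ ∈ B
  · linarith [hz σ hσ]
  · rw [memB] at hσ
    push Not at hσ
    rw [hσ.1, hσ.2]

end Chains

/-! ### Barycentric subdivision of a simplicial complex -/

section Subdivision

variable {E : Type*} [NormedAddCommGroup E] [NormedSpace ℝ E]

theorem barycenter_eq_sum {s : Finset E} (hs : s.Nonempty) :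
    barycenter s = ∑ v ∈ s, (s.card : ℝ)⁻¹ • v := by
  rw [barycenter, Finset.centroid_def,
    Finset.affineCombination_eq_linear_combination _ _ _
      (s.sum_centroidWeights_eq_one_of_nonempty ℝ hs)]
  simp

theorem barycenter_mem_convexHull {s : Finset E} (hs : s.Nonempty) :
    barycenter s ∈ convexHull ℝ (s : Set E) :=
  s.centroid_mem_convexHull hs

theorem mem_barycentricSubdivision_iff {F : Set (Finset E)} {t : Finset E} :
    t ∈ barycentricSubdivision F ↔ ∃ c : Finset (Finset E), c.Nonempty ∧
      (c : Set (Finset E)) ⊆ F ∧ IsChain (· ⊆ ·) (c : Set (Finset E)) ∧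
      t = c.image barycenter := by
  simp only [barycentricSubdivision, ← Finset.coe_image, Finset.coe_inj]
  rfl

theorem exists_top_of_isChain {α : Type*} {c : Finset (Finset α)} (hne : c.Nonempty)
    (hc : IsChain (· ⊆ ·) (c : Set (Finset α))) : ∃ T ∈ c, ∀ σ ∈ c, σ ⊆ T := by
  obtain ⟨T, hT, hmax⟩ := Finset.exists_max_image c Finset.card hne
  refine ⟨T, hT, fun σ hσ => ?_⟩
  rcases hc.total hσ hT with h | h
  · exact h
  · exact (Finset.eq_of_subset_of_card_le h (hmax σ hσ)).ge

/-- The simplices of the barycentric subdivision of a simplex cover it. -/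
theorem exists_chain_mem_convexHull (s : Finset E) :
    ∀ x ∈ convexHull ℝ (s : Set E), ∃ c : Finset (Finset E), c.Nonempty ∧
      (∀ σ ∈ c, σ.Nonempty ∧ σ ⊆ s) ∧ IsChain (· ⊆ ·) (c : Set (Finset E)) ∧
      x ∈ convexHull ℝ ((c.image barycenter : Finset E) : Set E) := by
  induction s using Finset.strongInduction with
  | H s ih =>
  intro x hx
  have hs : s.Nonempty := by
    simpa using convexHull_nonempty_iff.1 ⟨x, hx⟩
  have hcard : (0 : ℝ) < s.card := by exact_mod_cast hs.card_pos
  obtain ⟨w, hw0, hw1, hwx⟩ := Finset.mem_convexHull'.1 hx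
  obtain ⟨v, hv, hmin⟩ := Finset.exists_min_image s w hs
  -- Split off as much of the barycenter as possible: the rest of `x` does not involve `v`, a vertex
  -- of minimal weight.
  set r : ℝ := w v * s.card with hr
  have hr0 : 0 ≤ r := mul_nonneg (hw0 v hv) hcard.le
  have hsum : ∑ u ∈ s, (w u - w v) = 1 - r := by
    rw [Finset.sum_sub_distrib, hw1, Finset.sum_const, nsmul_eq_mul, hr, mul_comm]
  have hxr : x = r • barycenter s + ∑ u ∈ s, (w u - w v) • u := by
    rw [barycenter_eq_sum hs, Finset.smul_sum, ← Finset.sum_add_distrib, ← hwx]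
    refine Finset.sum_congr rfl fun u _ => ?_
    rw [smul_smul, ← add_smul, hr, mul_assoc, mul_inv_cancel₀ hcard.ne']
    congr 1
    ring
  have hr1 : r ≤ 1 := by
    have : 0 ≤ ∑ u ∈ s, (w u - w v) := Finset.sum_nonneg fun u hu => sub_nonneg.2 (hmin u hu)
    linarith
  rcases hr1.eq_or_lt with hr1 | hr1
  · refine ⟨{s}, by simp, by simp [hs], by simp, ?_⟩
    have hz : ∀ u ∈ s, w u - w v = 0 :=
      (Finset.sum_eq_zero_iff_of_nonneg fun u hu => sub_nonneg.2 (hmin u hu)).1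
        (by rw [hsum, hr1, sub_self])
    rw [hxr, hr1, Finset.sum_eq_zero fun u hu => by rw [hz u hu, zero_smul]]
    simp
  · have hr1' : 0 < 1 - r := sub_pos.2 hr1
    have hy : ∑ u ∈ s.erase v, ((1 - r)⁻¹ * (w u - w v)) • u ∈
        convexHull ℝ ((s.erase v : Finset E) : Set E) := by
      rw [Finset.mem_convexHull']
      refine ⟨fun u => (1 - r)⁻¹ * (w u - w v), fun u hu => ?_, ?_, rfl⟩
      · exact mul_nonneg (inv_nonneg.2 hr1'.le)
          (sub_nonneg.2 (hmin u (Finset.mem_of_mem_erase hu)))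
      · rw [← Finset.mul_sum, Finset.sum_erase _ (sub_self _), hsum, inv_mul_cancel₀ hr1'.ne']
    obtain ⟨c, hcne, hcs, hcc, hyc⟩ := ih _ (Finset.erase_ssubset hv) _ hy
    refine ⟨insert s c, by simp, ?_, ?_, ?_⟩
    · intro σ hσ
      rcases Finset.mem_insert.1 hσ with rfl | hσ
      · exact ⟨hs, subset_rfl⟩
      · exact ⟨(hcs σ hσ).1, (hcs σ hσ).2.trans (Finset.erase_subset _ _)⟩
    · rw [Finset.coe_insert]
      exact hcc.insert fun τ hτ _ => Or.inr ((hcs τ hτ).2.trans (Finset.erase_subset _ _))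
    · have hb : barycenter s ∈
          convexHull ℝ (((insert s c).image barycenter : Finset E) : Set E) :=
        subset_convexHull _ _ (by simp)
      have hyc' := convexHull_mono (𝕜 := ℝ) (s := ((c.image barycenter : Finset E) : Set E))
        (t := (((insert s c).image barycenter : Finset E) : Set E))
        (by simp [Set.subset_insert]) hyc
      have := convex_convexHull ℝ _ hb hyc' hr0 hr1'.le (by ring)
      convert this using 1
      rw [hxr, Finset.smul_sum, ← Finset.sum_erase s (a := v) (by rw [sub_self, zero_smul])]
      congr 1
      refine Finset.sum_congr rfl fun u _ => ?_
      rw [smul_smul, mul_inv_cancel_left₀ hr1'.ne']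

/-- Barycentric coordinates with respect to a simplicial complex do not depend on the simplex used to
compute them. -/
theorem weights_unique (K : SimplicialComplex ℝ E) {s t : Finset E} (hs : s ∈ K.faces)
    (ht : t ∈ K.faces) {w w' : E → ℝ} (hw : ∀ v, 0 ≤ w v) (hw' : ∀ v, 0 ≤ w' v)
    (hws : ∀ v ∉ s, w v = 0) (hwt : ∀ v ∉ t, w' v = 0)
    (hw1 : ∑ v ∈ s, w v = 1) (hw1' : ∑ v ∈ t, w' v = 1)
    (h : ∑ v ∈ s, w v • v = ∑ v ∈ t, w' v • v) : w = w' := by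
  have hx : ∑ v ∈ s, w v • v ∈ convexHull ℝ ((s ∩ t : Finset E) : Set E) := by
    rw [Finset.coe_inter]
    refine K.inter_subset_convexHull hs ht ⟨?_, ?_⟩
    · exact Finset.mem_convexHull'.2 ⟨w, fun v _ => hw v, hw1, rfl⟩
    · exact h ▸ Finset.mem_convexHull'.2 ⟨w', fun v _ => hw' v, hw1', rfl⟩
  obtain ⟨z, -, hz1, hzx⟩ := Finset.mem_convexHull'.1 hx
  -- Both weights agree with the weight `z` on `s ∩ t`, extended by zero.
  have key : ∀ u ∈ K.faces, s ∩ t ⊆ u → ∀ y : E → ℝ, (∀ v ∉ u, y v = 0) → ∑ v ∈ u, y v = 1 →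
      ∑ v ∈ u, y v • v = ∑ v ∈ s, w v • v → y = fun v => if v ∈ s ∩ t then z v else 0 := by
    intro u hu hsu y hy hy1 hyx
    have hd := linearIndepOn_prodMk_iff.1 (affineIndependent_coe_iff.1 (K.indep hu))
      (fun v => y v - if v ∈ s ∩ t then z v else 0) ?_ ?_
    · funext v
      by_cases hv : v ∈ u
      · exact sub_eq_zero.1 (hd v hv)
      · rw [hy v hv, if_neg fun h => hv (hsu h)]
    · simp only [sub_smul, Finset.sum_sub_distrib, ite_smul, zero_smul]
      rw [← Finset.sum_filter, Finset.filter_mem_eq_inter, Finset.inter_eq_right.2 hsu, hzx, hyx,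
        sub_self]
    · simp only [Finset.sum_sub_distrib]
      rw [← Finset.sum_filter, Finset.filter_mem_eq_inter, Finset.inter_eq_right.2 hsu, hz1, hy1,
        sub_self]
  rw [key s hs Finset.inter_subset_left w hws hw1 rfl,
    ← key t ht Finset.inter_subset_right w' hwt hw1' h.symm]

theorem barycenter_injOn (K : SimplicialComplex ℝ E) : Set.InjOn barycenter K.faces := by
  intro σ hσ τ hτ h
  have hne := K.nonempty_of_mem_faces hσ
  have hne' := K.nonempty_of_mem_faces hτ
  have hσ0 : (σ.card : ℝ) ≠ 0 := by exact_mod_cast hne.card_pos.ne'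
  have hτ0 : (τ.card : ℝ) ≠ 0 := by exact_mod_cast hne'.card_pos.ne'
  have := weights_unique K hσ hτ (w := fun v => if v ∈ σ then (σ.card : ℝ)⁻¹ else 0)
    (w' := fun v => if v ∈ τ then (τ.card : ℝ)⁻¹ else 0)
    (fun v => by positivity) (fun v => by positivity) (fun v hv => by simp [hv])
    (fun v hv => by simp [hv]) (by simp [hσ0]) (by simp [hτ0])
    (by
      rw [barycenter_eq_sum hne, barycenter_eq_sum hne'] at h
      simpa [Finset.sum_ite_mem, ite_smul] using h)
  ext v
  have hv := congrFun this v
  by_cases h1 : v ∈ σ <;> by_cases h2 : v ∈ τ <;>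
    simp only [h1, h2, if_true, if_false, inv_eq_zero, zero_eq_inv] at hv ⊢
  exacts [(hσ0 hv).elim, (hτ0 hv.symm).elim]

/-- A weight `u σ` on the barycenter of each `σ ∈ c` amounts to a weight on each vertex, the
weight of every barycenter being spread evenly over the vertices of its simplex. -/
def vertexWeight {α : Type*} (c : Finset (Finset α)) (u : Finset α → ℝ) (v : α) : ℝ :=
  ∑ σ ∈ c with v ∈ σ, u σ * (σ.card : ℝ)⁻¹

theorem sum_vertexWeight_smul {α W : Type*} [AddCommGroup W] [Module ℝ W]
    {c : Finset (Finset α)} {s : Finset α} (hcs : ∀ σ ∈ c, σ ⊆ s) (u : Finset α → ℝ) (f : α → W) :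
    ∑ v ∈ s, vertexWeight c u v • f v =
      ∑ σ ∈ c, u σ • ∑ v ∈ σ, (σ.card : ℝ)⁻¹ • f v := by
  simp only [vertexWeight, Finset.sum_smul, Finset.sum_filter, Finset.smul_sum, smul_smul]
  rw [Finset.sum_comm]
  refine Finset.sum_congr rfl fun σ hσ => ?_
  simp only [ite_smul, zero_smul]
  rw [← Finset.sum_filter, Finset.filter_mem_eq_inter, Finset.inter_eq_right.2 (hcs σ hσ)]

theorem sum_vertexWeight_smul_id {c : Finset (Finset E)} {s : Finset E}
    (hne : ∀ σ ∈ c, σ.Nonempty) (hcs : ∀ σ ∈ c, σ ⊆ s) (u : Finset E → ℝ) :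
    ∑ v ∈ s, vertexWeight c u v • v = ∑ σ ∈ c, u σ • barycenter σ := by
  rw [sum_vertexWeight_smul hcs u fun v => v]
  exact Finset.sum_congr rfl fun σ hσ => by rw [barycenter_eq_sum (hne σ hσ)]

theorem sum_vertexWeight {α : Type*} {c : Finset (Finset α)} {s : Finset α}
    (hne : ∀ σ ∈ c, σ.Nonempty) (hcs : ∀ σ ∈ c, σ ⊆ s) (u : Finset α → ℝ) :
    ∑ v ∈ s, vertexWeight c u v = ∑ σ ∈ c, u σ := by
  have := sum_vertexWeight_smul hcs u fun _ => (1 : ℝ)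
  simp only [smul_eq_mul, mul_one] at this
  rw [this]
  refine Finset.sum_congr rfl fun σ hσ => ?_
  have h0 : (σ.card : ℝ) ≠ 0 := by exact_mod_cast (hne σ hσ).card_pos.ne'
  simp [h0]

theorem vertexWeight_eq_zero {α : Type*} {c : Finset (Finset α)} {s : Finset α}
    (hcs : ∀ σ ∈ c, σ ⊆ s) (u : Finset α → ℝ) {v : α} (hv : v ∉ s) : vertexWeight c u v = 0 :=
  Finset.sum_eq_zero fun σ hσ => by
    rw [Finset.mem_filter] at hσ
    exact absurd (hcs σ hσ.1 hσ.2) hv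

/-- The barycenters of a chain of simplices are affinely independent. -/
theorem linearIndepOn_barycenter (K : SimplicialComplex ℝ E) {c : Finset (Finset E)}
    (hcne : c.Nonempty) (hcK : (c : Set (Finset E)) ⊆ K.faces)
    (hc : IsChain (· ⊆ ·) (c : Set (Finset E))) :
    LinearIndepOn ℝ (fun σ : Finset E => (barycenter σ, (1 : ℝ))) (c : Set (Finset E)) := by
  obtain ⟨T, hT, hTc⟩ := exists_top_of_isChain hcne hc
  have hne : ∀ σ ∈ c, σ.Nonempty := fun σ hσ => K.nonempty_of_mem_faces (hcK hσ)
  rw [linearIndepOn_prodMk_iff]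
  intro d hd hd0 σ hσ
  have hz := linearIndepOn_prodMk_iff.1 (affineIndependent_coe_iff.1 (K.indep (hcK hT)))
    (vertexWeight c d) (by rw [sum_vertexWeight_smul_id hne hTc, hd])
    (by rw [sum_vertexWeight hne hTc, hd0])
  have := eq_zero_of_sum_chain_eq_zero hc hne (d := fun σ => d σ * (σ.card : ℝ)⁻¹) (fun v => by
    by_cases hv : v ∈ T
    · exact hz v hv
    · exact vertexWeight_eq_zero hTc d hv) σ hσ
  have h0 : (σ.card : ℝ)⁻¹ ≠ 0 := inv_ne_zero (by exact_mod_cast (hne σ hσ).card_pos.ne')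
  exact (mul_eq_zero.1 this).resolve_right h0

theorem exists_chain_weights {c : Finset (Finset E)} {K : SimplicialComplex ℝ E}
    (hcK : (c : Set (Finset E)) ⊆ K.faces) {x : E}
    (hx : x ∈ convexHull ℝ ((c.image barycenter : Finset E) : Set E)) :
    ∃ u : Finset E → ℝ, (∀ σ, 0 ≤ u σ) ∧ (∀ σ ∉ c, u σ = 0) ∧ ∑ σ ∈ c, u σ = 1 ∧
      ∑ σ ∈ c, u σ • barycenter σ = x := by
  obtain ⟨w, hw0, hw1, hwx⟩ := Finset.mem_convexHull'.1 hx
  have hinj : Set.InjOn barycenter (c : Set (Finset E)) := (barycenter_injOn K).mono hcK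
  rw [Finset.sum_image hinj] at hw1 hwx
  refine ⟨fun σ => if σ ∈ c then w (barycenter σ) else 0, fun σ => ?_, fun σ hσ => if_neg hσ,
    ?_, ?_⟩
  · dsimp only
    split_ifs with h
    · exact hw0 _ (Finset.mem_image_of_mem _ h)
    · exact le_rfl
  · rw [← hw1]
    exact Finset.sum_congr rfl fun σ hσ => if_pos hσ
  · rw [← hwx]
    exact Finset.sum_congr rfl fun σ hσ => by simp only [if_pos hσ]

/-- Simplices of the barycentric subdivision meet in the simplex spanned by their common vertices. -/
theorem convexHull_image_barycenter_inter (K : SimplicialComplex ℝ E) {c d : Finset (Finset E)}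
    (hcne : c.Nonempty) (hdne : d.Nonempty)
    (hcK : (c : Set (Finset E)) ⊆ K.faces) (hdK : (d : Set (Finset E)) ⊆ K.faces)
    (hc : IsChain (· ⊆ ·) (c : Set (Finset E))) (hd : IsChain (· ⊆ ·) (d : Set (Finset E))) :
    convexHull ℝ ((c.image barycenter : Finset E) : Set E) ∩
        convexHull ℝ ((d.image barycenter : Finset E) : Set E) ⊆
      convexHull ℝ (((c ∩ d).image barycenter : Finset E) : Set E) := by
  rintro x ⟨hxc, hxd⟩
  obtain ⟨u, hu0, huc, hu1, hux⟩ := exists_chain_weights hcK hxc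
  obtain ⟨u', hu0', hud, hu1', hux'⟩ := exists_chain_weights hdK hxd
  obtain ⟨T, hT, hTc⟩ := exists_top_of_isChain hcne hc
  obtain ⟨T', hT', hTd⟩ := exists_top_of_isChain hdne hd
  have hne : ∀ σ ∈ c, σ.Nonempty := fun σ hσ => K.nonempty_of_mem_faces (hcK hσ)
  have hne' : ∀ σ ∈ d, σ.Nonempty := fun σ hσ => K.nonempty_of_mem_faces (hdK hσ)
  have hnn : ∀ (u : Finset E → ℝ), (∀ σ, 0 ≤ u σ) → ∀ σ, 0 ≤ u σ * (σ.card : ℝ)⁻¹ :=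
    fun u hu σ => mul_nonneg (hu σ) (by positivity)
  have hW : vertexWeight c u = vertexWeight d u' :=
    weights_unique K (hcK hT) (hdK hT')
      (fun v => Finset.sum_nonneg fun σ _ => hnn u hu0 σ)
      (fun v => Finset.sum_nonneg fun σ _ => hnn u' hu0' σ)
      (fun v hv => vertexWeight_eq_zero hTc u hv) (fun v hv => vertexWeight_eq_zero hTd u' hv)
      (by rw [sum_vertexWeight hne hTc, hu1]) (by rw [sum_vertexWeight hne' hTd, hu1'])
      (by rw [sum_vertexWeight_smul_id hne hTc, sum_vertexWeight_smul_id hne' hTd, hux, hux'])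
  have ha := chain_weights_unique hc hd hne hne' (hnn u hu0) (hnn u' hu0')
    (fun σ hσ => by rw [huc σ hσ, zero_mul]) (fun σ hσ => by rw [hud σ hσ, zero_mul])
    (fun v => congrFun hW v)
  have hzero : ∀ σ ∈ c, σ ∉ c ∩ d → u σ = 0 := by
    intro σ hσ hσd
    have h1 := congrFun ha σ
    have h2 : u' σ = 0 := hud σ fun h => hσd (Finset.mem_inter.2 ⟨hσ, h⟩)
    have h0 : (σ.card : ℝ)⁻¹ ≠ 0 := inv_ne_zero (by exact_mod_cast (hne σ hσ).card_pos.ne')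
    rw [h2, zero_mul] at h1
    exact (mul_eq_zero.1 h1).resolve_right h0
  rw [← hux, ← Finset.sum_subset Finset.inter_subset_left
    fun σ hσ hσd => by rw [hzero σ hσ hσd, zero_smul]]
  refine (convex_convexHull ℝ _).sum_mem (fun σ _ => hu0 σ) ?_ fun σ hσ =>
    subset_convexHull _ _ (Finset.mem_coe.2 (Finset.mem_image_of_mem _ hσ))
  rw [Finset.sum_subset Finset.inter_subset_left hzero, hu1]

/-- The barycentric subdivision of a geometric simplicial complex, as a simplicial complex. -/
def subdivision (K : SimplicialComplex ℝ E) : SimplicialComplex ℝ E where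
  faces := barycentricSubdivision K.faces
  isRelLowerSet_faces := by
    intro s hs
    obtain ⟨c, hcne, hcK, hc, rfl⟩ := mem_barycentricSubdivision_iff.1 hs
    refine ⟨hcne.image _, fun t hts ht => ?_⟩
    obtain ⟨d, hdc, rfl⟩ := Finset.subset_image_iff.1 hts
    exact mem_barycentricSubdivision_iff.2 ⟨d, by simpa using ht,
      (Finset.coe_subset.2 hdc).trans hcK, hc.mono (Finset.coe_subset.2 hdc), rfl⟩
  indep := by
    intro s hs
    obtain ⟨c, hcne, hcK, hc, rfl⟩ := mem_barycentricSubdivision_iff.1 hs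
    have h := linearIndepOn_barycenter K hcne hcK hc
    have hinj : Set.InjOn barycenter (c : Set (Finset E)) := (barycenter_injOn K).mono hcK
    rw [affineIndependent_coe_iff, linearIndepOn_prodMk_iff]
    intro d
    rw [Finset.sum_image hinj, Finset.sum_image hinj, Finset.forall_mem_image]
    exact linearIndepOn_prodMk_iff.1 h fun σ => d (barycenter σ)
  inter_subset_convexHull := by
    intro s t hs ht
    obtain ⟨c, hcne, hcK, hc, rfl⟩ := mem_barycentricSubdivision_iff.1 hs
    obtain ⟨d, hdne, hdK, hd, rfl⟩ := mem_barycentricSubdivision_iff.1 ht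
    refine (convexHull_image_barycenter_inter K hcne hdne hcK hdK hc hd).trans
      (convexHull_mono ?_)
    rw [← Finset.coe_inter]
    exact Finset.coe_subset.2 (Finset.image_inter_subset _ _ _)

theorem convexHull_image_barycenter_subset {c : Finset (Finset E)} {T : Finset E}
    (hne : ∀ σ ∈ c, σ.Nonempty) (hT : ∀ σ ∈ c, σ ⊆ T) :
    convexHull ℝ ((c.image barycenter : Finset E) : Set E) ⊆ convexHull ℝ (T : Set E) := by
  refine convexHull_min ?_ (convex_convexHull ℝ _)
  rw [Finset.coe_image]
  rintro _ ⟨σ, hσ, rfl⟩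
  exact convexHull_mono (Finset.coe_subset.2 (hT σ hσ)) (barycenter_mem_convexHull (hne σ hσ))

theorem subdivision_space (K : SimplicialComplex ℝ E) : (subdivision K).space = K.space := by
  ext x
  rw [SimplicialComplex.mem_space_iff, SimplicialComplex.mem_space_iff]
  constructor
  · rintro ⟨t, ht, hx⟩
    obtain ⟨c, hcne, hcK, hc, rfl⟩ := mem_barycentricSubdivision_iff.1 ht
    obtain ⟨T, hT, hTc⟩ := exists_top_of_isChain hcne hc
    exact ⟨T, hcK hT, convexHull_image_barycenter_subset
      (fun σ hσ => K.nonempty_of_mem_faces (hcK hσ)) hTc hx⟩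
  · rintro ⟨s, hs, hx⟩
    obtain ⟨c, hcne, hcs, hc, hx⟩ := exists_chain_mem_convexHull s x hx
    exact ⟨_, mem_barycentricSubdivision_iff.2 ⟨c, hcne,
      fun σ hσ => K.down_closed hs (hcs σ hσ).2 (hcs σ hσ).1, hc, rfl⟩, hx⟩

theorem subdivision_faces_finite {K : SimplicialComplex ℝ E} (hK : K.faces.Finite) :
    (subdivision K).faces.Finite := by
  refine ((hK.toFinset.powerset.finite_toSet).image (Finset.image barycenter)).subset ?_
  rintro t ht
  obtain ⟨c, -, hcK, -, rfl⟩ := mem_barycentricSubdivision_iff.1 ht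
  exact ⟨c, by simpa using hcK, rfl⟩

end Subdivision

/-! ### Simplicial actions -/

section Action

variable {E : Type*} [NormedAddCommGroup E] [NormedSpace ℝ E]
  {G : Type*} [Group G] [MulAction G E] {K : SimplicialComplex ℝ E}

/-- Every `g : G` maps the faces of `K` to faces of `K`, and is affine on each of them. The action
is an arbitrary action on the whole space `E`; only its values on `K.space` matter. -/
def IsSimplicialAction (G : Type*) [Group G] [MulAction G E] (K : SimplicialComplex ℝ E) : Prop :=
  ∀ g : G, ∀ s ∈ K.faces, g • s ∈ K.faces ∧
    ∃ A : E →ᵃ[ℝ] E, ∀ x ∈ convexHull ℝ (s : Set E), g • x = A x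

theorem IsSimplicialAction.smul_barycenter (h : IsSimplicialAction G K) (g : G) {s : Finset E}
    (hs : s ∈ K.faces) : g • barycenter s = barycenter (g • s) := by
  obtain ⟨-, A, hA⟩ := h g s hs
  have hne := K.nonempty_of_mem_faces hs
  have hmap : g • s = s.map (MulAction.toPerm g).toEmbedding := by
    rw [Finset.map_eq_image]; rfl
  rw [hA _ (barycenter_mem_convexHull hne), barycenter, barycenter, hmap, Finset.centroid_map,
    Finset.centroid_def, Finset.centroid_def,
    Finset.map_affineCombination _ _ _ (s.sum_centroidWeights_eq_one_of_nonempty ℝ hne)]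
  refine Finset.affineCombination_congr _ (fun _ _ => rfl) fun v hv => ?_
  exact (hA v (subset_convexHull _ _ hv)).symm

theorem IsSimplicialAction.smul_image_barycenter (h : IsSimplicialAction G K) (g : G)
    {c : Finset (Finset E)} (hc : (c : Set (Finset E)) ⊆ K.faces) :
    g • c.image barycenter = (g • c).image barycenter := by
  change (c.image barycenter).image (g • ·) = (c.image (g • ·)).image barycenter
  rw [Finset.image_image, Finset.image_image]
  exact Finset.image_congr fun σ hσ => h.smul_barycenter g (hc hσ)

theorem IsSimplicialAction.subdivision (h : IsSimplicialAction G K) :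
    IsSimplicialAction G (subdivision K) := by
  intro g t ht
  obtain ⟨c, hcne, hcK, hc, rfl⟩ := mem_barycentricSubdivision_iff.1 ht
  constructor
  · rw [h.smul_image_barycenter g hcK]
    refine mem_barycentricSubdivision_iff.2 ⟨g • c, hcne.smul_finset, ?_, ?_, rfl⟩
    · rintro _ hgσ
      obtain ⟨σ, hσ, rfl⟩ := Finset.mem_smul_finset.1 (Finset.mem_coe.1 hgσ)
      exact (h g σ (hcK hσ)).1
    · rintro _ hgσ _ hgτ _
      obtain ⟨σ, hσ, rfl⟩ := Finset.mem_smul_finset.1 (Finset.mem_coe.1 hgσ)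
      obtain ⟨τ, hτ, rfl⟩ := Finset.mem_smul_finset.1 (Finset.mem_coe.1 hgτ)
      exact (hc.total hσ hτ).imp Finset.smul_finset_subset_smul_finset
        Finset.smul_finset_subset_smul_finset
  · obtain ⟨T, hT, hTc⟩ := exists_top_of_isChain hcne hc
    obtain ⟨-, A, hA⟩ := h g T (hcK hT)
    exact ⟨A, fun x hx => hA x (convexHull_image_barycenter_subset
      (fun σ hσ => K.nonempty_of_mem_faces (hcK hσ)) hTc hx)⟩

/-- Two vertices of a simplex of the barycentric subdivision that lie in one orbit are equal: they
are barycenters of simplices of equal dimension in a chain. -/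
theorem IsSimplicialAction.smul_eq_of_mem_subdivision (h : IsSimplicialAction G K) {g : G}
    {t : Finset E} (ht : t ∈ (EquivariantPL.subdivision K).faces) {v : E} (hv : v ∈ t)
    (hgv : g • v ∈ t) : g • v = v := by
  obtain ⟨c, -, hcK, hc, rfl⟩ := mem_barycentricSubdivision_iff.1 ht
  obtain ⟨σ, hσ, rfl⟩ := Finset.mem_image.1 hv
  obtain ⟨τ, hτ, hτσ⟩ := Finset.mem_image.1 hgv
  rw [h.smul_barycenter g (hcK hσ)] at hτσ ⊢
  have hτ' := barycenter_injOn K (hcK hτ) (h g σ (hcK hσ)).1 hτσ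
  have hcard : τ.card = σ.card := by rw [hτ', Finset.card_smul_finset]
  rw [← hτ']
  rcases hc.total hσ hτ with h1 | h1
  · rw [Finset.eq_of_subset_of_card_le h1 hcard.le]
  · rw [Finset.eq_of_subset_of_card_le h1 hcard.ge]

/-- Stabilizers of vertices decrease along a chain of simplices of the subdivision. -/
theorem IsSimplicialAction.smul_barycenter_eq_of_subset (h : IsSimplicialAction G K) {g : G}
    {σ τ : Finset E} (hσ : σ ∈ (EquivariantPL.subdivision K).faces)
    (hτ : τ ∈ (EquivariantPL.subdivision K).faces)
    (hστ : σ ⊆ τ) (hg : g • barycenter τ = barycenter τ) : g • barycenter σ = barycenter σ := by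
  rw [h.subdivision.smul_barycenter g hτ] at hg
  have hgτ : g • τ = τ := barycenter_injOn _ (h.subdivision g τ hτ).1 hτ hg
  rw [h.subdivision.smul_barycenter g hσ]
  congr 1
  change σ.image (g • ·) = σ
  conv_rhs => rw [← Finset.image_id (s := σ)]
  refine Finset.image_congr fun v hv => ?_
  refine h.smul_eq_of_mem_subdivision hτ (hστ hv) ?_
  have := Finset.smul_mem_smul_finset (a := g) (hστ hv)
  rwa [hgτ] at this

end Action

/-! ### Equivariant maps from vertex values -/

section Extension

variable {E : Type*} [NormedAddCommGroup E] [NormedSpace ℝ E]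
  {V : Type*} [NormedAddCommGroup V] [NormedSpace ℝ V]
  {G : Type*} [Group G] [MulAction G E] {K : SimplicialComplex ℝ E}

theorem exists_affineMap_eqOn {s : Finset E} (hs : AffineIndependent ℝ ((↑) : s → E))
    (φ : E → V) : ∃ A : E →ᵃ[ℝ] V, ∀ v ∈ s, A v = φ v := by
  obtain ⟨A, hA⟩ := exists_affineMap_apply_eq (affineIndependent_coe_iff.1 hs) fun v => φ v
  exact ⟨A, fun v hv => hA ⟨v, hv⟩⟩

theorem eqOn_convexHull_of_eqOn {s : Set E} {A B : E →ᵃ[ℝ] V} (h : ∀ v ∈ s, A v = B v) :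
    ∀ x ∈ convexHull ℝ s, A x = B x := fun _ hx =>
  AffineMap.eqOn_affineSpan (k := ℝ) h (convexHull_subset_affineSpan s hx)

/-- An equivariant assignment of values to the vertices extends to an equivariant map which is affine
on each simplex. Its values outside `K.space` are irrelevant. -/
theorem exists_equivariant_extension [FiniteDimensional ℝ E] (hKfin : K.faces.Finite)
    (hact : IsSimplicialAction G K) (ρ : Representation ℝ G V) {φ : E → V}
    (hφ : ∀ (g : G) v, φ (g • v) = ρ g (φ v)) :
    ∃ f : E → V, ContinuousOn f K.space ∧ (∀ (g : G), ∀ x ∈ K.space, f (g • x) = ρ g (f x)) ∧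
      (∀ s ∈ K.faces, ∃ A : E →ᵃ[ℝ] V, ∀ x ∈ convexHull ℝ (s : Set E), f x = A x) ∧
      ∀ s ∈ K.faces, ∀ v ∈ s, f v = φ v := by
  have hA : ∀ s : K.faces, ∃ A : E →ᵃ[ℝ] V, ∀ v ∈ (s : Finset E), A v = φ v :=
    fun s => exists_affineMap_eqOn (K.indep s.2) φ
  choose A hA using hA
  have hcompat : ∀ s t : K.faces, ∀ x ∈ convexHull ℝ ((s : Finset E) : Set E),
      x ∈ convexHull ℝ ((t : Finset E) : Set E) → A s x = A t x := fun s t x hxs hxt =>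
    eqOn_convexHull_of_eqOn (fun v hv => (hA s v hv.1).trans (hA t v hv.2).symm) x
      (K.inter_subset_convexHull s.2 t.2 ⟨hxs, hxt⟩)
  let f : E → V := fun x =>
    if h : ∃ s : K.faces, x ∈ convexHull ℝ ((s : Finset E) : Set E) then A h.choose x else 0
  have hf : ∀ s : K.faces, ∀ x ∈ convexHull ℝ ((s : Finset E) : Set E), f x = A s x := by
    intro s x hx
    have h : ∃ s : K.faces, x ∈ convexHull ℝ ((s : Finset E) : Set E) := ⟨s, hx⟩
    simp only [f, dif_pos h]
    exact hcompat _ _ x h.choose_spec hx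
  refine ⟨f, ?_, ?_, fun s hs => ⟨A ⟨s, hs⟩, hf ⟨s, hs⟩⟩, fun s hs v hv => ?_⟩
  · have := hKfin.to_subtype
    have hspace : K.space = ⋃ s : K.faces, convexHull ℝ ((s : Finset E) : Set E) := by
      rw [SimplicialComplex.space, Set.biUnion_eq_iUnion]
    rw [hspace]
    refine (locallyFinite_of_finite _).continuousOn_iUnion
      (fun s => (s : Finset E).finite_toSet.isClosed_convexHull ℝ) fun s => ?_
    exact (A s).continuous_of_finiteDimensional.continuousOn.congr (hf s)
  · intro g x hx
    obtain ⟨s, hs, hxs⟩ := SimplicialComplex.mem_space_iff.1 hx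
    obtain ⟨hgs, B, hB⟩ := hact g s hs
    have hBs : ∀ y ∈ convexHull ℝ (s : Set E), B y ∈ convexHull ℝ ((g • s : Finset E) : Set E) := by
      intro y hy
      have h1 : B y ∈ B '' convexHull ℝ (s : Set E) := ⟨y, hy, rfl⟩
      rw [AffineMap.image_convexHull] at h1
      refine convexHull_mono ?_ h1
      rintro _ ⟨v, hv, rfl⟩
      rw [← hB v (subset_convexHull _ _ hv)]
      exact Finset.mem_coe.2 (Finset.smul_mem_smul_finset hv)
    rw [hB x hxs, hf ⟨g • s, hgs⟩ _ (hBs x hxs), hf ⟨s, hs⟩ x hxs]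
    refine eqOn_convexHull_of_eqOn (A := (A ⟨g • s, hgs⟩).comp B)
      (B := (ρ g).toAffineMap.comp (A ⟨s, hs⟩)) (fun v hv => ?_) x hxs
    have hgv : g • v ∈ g • s := Finset.smul_mem_smul_finset hv
    simp only [AffineMap.comp_apply, LinearMap.coe_toAffineMap]
    rw [← hB v (subset_convexHull _ _ hv), hA ⟨g • s, hgs⟩ _ hgv, hA ⟨s, hs⟩ v hv, hφ]
  · rw [hf ⟨s, hs⟩ v (subset_convexHull _ _ hv), hA ⟨s, hs⟩ v hv]

end Extension

/-! ### Generic vertex values on one simplex -/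

section Choice

/-- Points in general position can be chosen in an increasing sequence of subspaces, as soon as
the dimension of each subspace is at least the number of points chosen before. -/
theorem exists_linearIndepOn_of_card_le_finrank {ι V : Type*} [AddCommGroup V] [Module ℝ V]
    [FiniteDimensional ℝ V] (n : ι → ℕ) (W : ι → Submodule ℝ V) (c : Finset ι)
    (hn : Set.InjOn n c) (hW : ∀ i ∈ c, ∀ j ∈ c, n i ≤ n j → W i ≤ W j)
    (hdim : ∀ i ∈ c, (c.filter (n · < n i)).card ≤ Module.finrank ℝ (W i)) :
    ∃ x : ι → V, (∀ i ∈ c, x i ∈ W i) ∧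
      LinearIndepOn ℝ (fun i => (x i, (1 : ℝ))) (c : Set ι) := by
  induction c using Finset.induction_on_max_value n with
  | empty => exact ⟨0, by simp, by simp⟩
  | insert a s has hmax ih =>
    obtain ⟨x, hxW, hx⟩ := ih (hn.mono (by simp))
      (fun i hi j hj => hW i (Finset.mem_insert_of_mem hi) j (Finset.mem_insert_of_mem hj))
      (fun i hi => le_trans (Finset.card_le_card
        (Finset.filter_subset_filter _ (Finset.subset_insert a s)))
        (hdim i (Finset.mem_insert_of_mem hi)))
    have hlt : ∀ i ∈ s, n i < n a := fun i hi => (hmax i hi).lt_of_ne fun h =>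
      has (hn (by simp [hi]) (by simp) h ▸ hi)
    have hcard : s.card ≤ Module.finrank ℝ (W a) := by
      convert hdim a (Finset.mem_insert_self a s) using 2
      ext i
      simp only [Finset.mem_filter, Finset.mem_insert]
      constructor
      · exact fun hi => ⟨Or.inr hi, hlt i hi⟩
      · rintro ⟨rfl | hi, h⟩
        · exact absurd h (lt_irrefl _)
        · exact hi
    set S := Submodule.span ℝ ((fun i => (x i, (1 : ℝ))) '' (s : Set ι)) with hS
    obtain ⟨w, hwW, hwS⟩ : ∃ w ∈ W a, (w, (1 : ℝ)) ∉ S := by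
      by_contra! hcon
      have hSfin : Module.finrank ℝ S ≤ s.card := by
        rw [hS, ← Finset.coe_image]
        exact (finrank_span_finset_le_card _).trans Finset.card_image_le
      have hmem : ∀ y : W a × ℝ, ((y.1 : V), y.2) ∈ S := by
        rintro ⟨y, r⟩
        have h1 := hcon y y.2
        have h0 := hcon 0 (zero_mem _)
        have := S.add_mem h1 (S.smul_mem (r - 1) h0)
        simpa using this
      -- Otherwise `S` would contain a copy of `W a × ℝ`, whose dimension is more than `s.card`.
      let L : W a × ℝ →ₗ[ℝ] S :=
        LinearMap.codRestrict S (LinearMap.prodMap (W a).subtype LinearMap.id) hmem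
      have hL : Function.Injective L := by
        intro y z hyz
        have : ((y.1 : V), y.2) = ((z.1 : V), z.2) := congrArg Subtype.val hyz
        simpa [Prod.ext_iff] using this
      have := LinearMap.finrank_le_finrank_of_injective hL
      rw [Module.finrank_prod, Module.finrank_self] at this
      omega
    have hne : ∀ i ∈ s, i ≠ a := fun i hi h => has (h ▸ hi)
    refine ⟨Function.update x a w, fun i hi => ?_, ?_⟩
    · rcases Finset.mem_insert.1 hi with rfl | hi
      · simpa using hwW
      · simpa [Function.update_of_ne (hne i hi)] using hxW i hi
    · have heq : ∀ i ∈ (s : Set ι),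
          (x i, (1 : ℝ)) = (Function.update x a w i, (1 : ℝ)) := fun i hi => by
        rw [Function.update_of_ne (hne i hi)]
      rw [Finset.coe_insert]
      refine LinearIndepOn.insert (hx.congr heq) ?_
      rw [← Set.image_congr heq, Function.update_self]
      exact hwS

variable {E : Type*} [NormedAddCommGroup E] [NormedSpace ℝ E]
  {V : Type*} [NormedAddCommGroup V] [NormedSpace ℝ V] [FiniteDimensional ℝ V]
  {G : Type*} [Group G] [MulAction G E] {K : SimplicialComplex ℝ E}

/-- Equivariant vertex values that are in general position on a given simplex `t` of the second
subdivision. -/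
theorem exists_equivariant_linearIndepOn (hact : IsSimplicialAction G K)
    (ρ : Representation ℝ G V)
    (hdim : ∀ (H : Subgroup G), ∀ s ∈ (subdivision (subdivision K)).faces,
      (∀ g ∈ H, ∀ v ∈ s, g • v = v) →
        s.card ≤ Module.finrank ℝ (Representation.invariants (ρ.comp H.subtype)) + 1)
    {t : Finset E} (ht : t ∈ (subdivision (subdivision K)).faces) :
    ∃ φ : E → V, (∀ (g : G) v, φ (g • v) = ρ g (φ v)) ∧
      LinearIndepOn ℝ (fun v => (φ v, (1 : ℝ))) (t : Set E) := by
  obtain ⟨c, hcne, hcK, hc, htc⟩ := mem_barycentricSubdivision_iff.1 ht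
  have hsub : ∀ σ ∈ c, ∀ τ ∈ c, σ.card ≤ τ.card → σ ⊆ τ := by
    intro σ hσ τ hτ h
    rcases hc.total hσ hτ with h1 | h1
    · exact h1
    · exact (Finset.eq_of_subset_of_card_le h1 h).ge
  have hinj : Set.InjOn barycenter (c : Set (Finset E)) := (barycenter_injOn _).mono hcK
  let W : Finset E → Submodule ℝ V := fun σ =>
    Representation.invariants (ρ.comp (MulAction.stabilizer G (barycenter σ)).subtype)
  have memW : ∀ σ x, x ∈ W σ ↔ ∀ g : G, g • barycenter σ = barycenter σ → ρ g x = x := by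
    intro σ x
    simp [W, Representation.mem_invariants]
  obtain ⟨x, hxW, hx⟩ := exists_linearIndepOn_of_card_le_finrank Finset.card W c
    (fun σ hσ τ hτ h => (hsub σ hσ τ hτ h.le).antisymm (hsub τ hτ σ hσ h.ge))
    (fun σ hσ τ hτ h y hy => (memW τ y).2 fun g hg => (memW σ y).1 hy g
      (hact.smul_barycenter_eq_of_subset (hcK hσ) (hcK hτ) (hsub σ hσ τ hτ h) hg))
    (fun σ hσ => by
      have hd : insert σ (c.filter (·.card < σ.card)) ⊆ c :=
        Finset.insert_subset hσ (Finset.filter_subset _ _)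
      have := hdim (MulAction.stabilizer G (barycenter σ))
        ((insert σ (c.filter (·.card < σ.card))).image barycenter)
        (SimplicialComplex.down_closed ht (htc ▸ Finset.image_subset_image hd) (by simp)) ?_
      · rw [Finset.card_image_of_injOn (hinj.mono (Finset.coe_subset.2 hd)),
          Finset.card_insert_of_notMem (by simp)] at this
        exact Nat.le_of_add_le_add_right this
      · intro g hg v hv
        obtain ⟨τ, hτ, rfl⟩ := Finset.mem_image.1 hv
        refine hact.smul_barycenter_eq_of_subset (hcK (hd hτ)) (hcK hσ) (hsub _ (hd hτ) _ hσ ?_) hg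
        rcases Finset.mem_insert.1 hτ with rfl | hτ
        · exact le_rfl
        · exact (Finset.mem_filter.1 hτ).2.le)
  -- The values `x σ` at the barycenters, transported along the orbits, and zero elsewhere.
  let φ : E → V := fun u =>
    if h : ∃ p : G × Finset E, p.2 ∈ c ∧ u = p.1 • barycenter p.2 then
      ρ h.choose.1 (x h.choose.2) else 0
  have hφ : ∀ (g : G), ∀ σ ∈ c, φ (g • barycenter σ) = ρ g (x σ) := by
    intro g σ hσ
    have h : ∃ p : G × Finset E, p.2 ∈ c ∧ g • barycenter σ = p.1 • barycenter p.2 :=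
      ⟨(g, σ), hσ, rfl⟩
    simp only [φ, dif_pos h]
    obtain ⟨hτ, hgτ⟩ := h.choose_spec
    set g' := h.choose.1
    set τ := h.choose.2
    have h1 : (g'⁻¹ * g) • barycenter σ = barycenter τ := by
      rw [mul_smul, hgτ, inv_smul_smul]
    have h2 : (g'⁻¹ * g) • barycenter σ = barycenter σ := by
      refine hact.subdivision.smul_eq_of_mem_subdivision ht ?_ ?_
      · exact htc ▸ Finset.mem_image_of_mem _ hσ
      · exact h1 ▸ htc ▸ Finset.mem_image_of_mem _ hτ
    have h3 : τ = σ := hinj hτ hσ (h1.symm.trans h2)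
    have h4 := (memW σ _).1 (hxW σ hσ) _ h2
    rw [h3]
    conv_lhs => rw [← h4]
    rw [← Module.End.mul_apply, ← map_mul, mul_inv_cancel_left]
  refine ⟨φ, fun g v => ?_, ?_⟩
  · by_cases h : ∃ p : G × Finset E, p.2 ∈ c ∧ v = p.1 • barycenter p.2
    · obtain ⟨⟨g', σ⟩, hσ, rfl⟩ := h
      rw [← mul_smul, hφ _ σ hσ, hφ _ σ hσ, map_mul]
      rfl
    · have h' : ¬ ∃ p : G × Finset E, p.2 ∈ c ∧ g • v = p.1 • barycenter p.2 := by
        rintro ⟨⟨g', σ⟩, hσ, hv⟩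
        exact h ⟨(g⁻¹ * g', σ), hσ, by rw [mul_smul, ← hv, inv_smul_smul]⟩
      simp only [φ, dif_neg h, dif_neg h', map_zero]
  · rw [htc, linearIndepOn_prodMk_iff]
    intro d
    rw [Finset.sum_image hinj, Finset.sum_image hinj, Finset.forall_mem_image]
    intro h1 h2
    refine linearIndepOn_prodMk_iff.1 hx (fun σ => d (barycenter σ)) ?_ h2
    rw [← h1]
    refine Finset.sum_congr rfl fun σ hσ => ?_
    have := hφ 1 σ hσ
    rw [one_smul, map_one] at this
    rw [this]
    rfl

end Choice

/-! ### Invariant triangulations -/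

section Invariant

variable {E : Type*} [NormedAddCommGroup E] [NormedSpace ℝ E]
  {G : Type*} [Group G] {P : Set E} {K : SimplicialComplex ℝ E}

/-- An action on `P`, extended to the ambient space by the identity outside `P`. -/
@[reducible]
def extendAction {E : Type*} (G : Type*) [Group G] (P : Set E) [MulAction G P] : MulAction G E where
  smul g x := if h : x ∈ P then ((g • (⟨x, h⟩ : P) : P) : E) else x
  one_smul x := by
    change (if h : x ∈ P then (((1 : G) • (⟨x, h⟩ : P) : P) : E) else x) = x
    simp
  mul_smul g h x := by
    change (if hx : x ∈ P then (((g * h) • (⟨x, hx⟩ : P) : P) : E) else x) =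
      if hy : (if hx : x ∈ P then ((h • (⟨x, hx⟩ : P) : P) : E) else x) ∈ P then
        ((g • (⟨_, hy⟩ : P) : P) : E)
      else (if hx : x ∈ P then ((h • (⟨x, hx⟩ : P) : P) : E) else x)
    by_cases hx : x ∈ P <;> simp [hx, mul_smul]

theorem coe_smul_eq_extendAction_smul {E : Type*} {P : Set E} [MulAction G P] (g : G) (x : P) :
    letI := extendAction G P
    ((g • x : P) : E) = g • (x : E) := by
  change _ = if h : (x : E) ∈ P then ((g • (⟨x, h⟩ : P) : P) : E) else x
  rw [dif_pos x.2]

theorem mem_extremePoints_convexHull {s : Finset E}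
    (hs : AffineIndependent ℝ ((↑) : s → E)) {v : E} (hv : v ∈ s) :
    v ∈ (convexHull ℝ (s : Set E)).extremePoints ℝ := by
  refine mem_extremePoints_iff_left.2 ⟨subset_convexHull _ _ hv, ?_⟩
  rintro x hx y hy ⟨a, b, ha, hb, hab, hxy⟩
  obtain ⟨w, hw0, hw1, rfl⟩ := Finset.mem_convexHull'.1 hx
  obtain ⟨z, hz0, hz1, rfl⟩ := Finset.mem_convexHull'.1 hy
  have hd := linearIndepOn_prodMk_iff.1 (affineIndependent_coe_iff.1 hs)
    (fun u => a * w u + b * z u - if u = v then 1 else 0) ?_ ?_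
  · have hwu : ∀ u ∈ s, u ≠ v → w u = 0 := by
      intro u hu huv
      have h1 := hd u hu
      rw [if_neg huv] at h1
      have h2 := mul_nonneg ha.le (hw0 u hu)
      have h3 := mul_nonneg hb.le (hz0 u hu)
      have h4 : a * w u = 0 := by linarith
      exact (mul_eq_zero.1 h4).resolve_left ha.ne'
    rw [Finset.sum_eq_single_of_mem v hv fun u hu huv => hwu u hu huv] at hw1
    rw [Finset.sum_eq_single_of_mem v hv fun u hu huv => by rw [hwu u hu huv, zero_smul], hw1,
      one_smul]
  · rw [Finset.smul_sum, Finset.smul_sum, ← Finset.sum_add_distrib] at hxy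
    simp only [sub_smul, add_smul, mul_smul, Finset.sum_sub_distrib, ite_smul, one_smul, zero_smul,
      Finset.sum_ite_eq', if_pos hv, hxy, sub_self]
  · simp only [Finset.sum_sub_distrib, Finset.sum_add_distrib, ← Finset.mul_sum, hw1, hz1,
      Finset.sum_ite_eq', if_pos hv, mul_one, hab, sub_self]

/-- An element `g` maps simplices onto simplices, hence vertices to vertices, these being the extreme
points. -/
theorem IsInvariantTriangulation.isSimplicialAction [MulAction G P] [MulAction G E]
    (hcoe : ∀ (g : G) (x : P), ((g • x : P) : E) = g • (x : E))
    (hK : IsInvariantTriangulation G K P) : IsSimplicialAction G K := by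
  have hP : ∀ s ∈ K.faces, convexHull ℝ (s : Set E) ⊆ P := fun s hs =>
    hK.space_eq ▸ SimplicialComplex.convexHull_subset_space hs
  have haff : ∀ g : G, ∀ s ∈ K.faces, ∃ A : E →ᵃ[ℝ] E, ∀ x ∈ convexHull ℝ (s : Set E),
      g • x = A x := by
    intro g s hs
    obtain ⟨A, hA⟩ := hK.linear g s hs
    exact ⟨A, fun x hx => (hcoe g ⟨x, hP s hs hx⟩).symm.trans (hA ⟨x, hP s hs hx⟩ hx)⟩
  have hvert : ∀ (g : G), ∀ s ∈ K.faces, ∀ t ∈ K.faces,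
      (g • ·) '' convexHull ℝ (s : Set E) = convexHull ℝ (t : Set E) →
        ∀ v ∈ t, ∃ u ∈ s, g • u = v := by
    intro g s hs t ht hst v hv
    obtain ⟨A, hA⟩ := haff g s hs
    have h1 := mem_extremePoints_convexHull (K.indep ht) hv
    rw [← hst, Set.image_congr hA, AffineMap.image_convexHull] at h1
    obtain ⟨u, hu, rfl⟩ := extremePoints_convexHull_subset h1
    exact ⟨u, hu, hA u (subset_convexHull _ _ hu)⟩
  intro g s hs
  refine ⟨?_, haff g s hs⟩
  obtain ⟨t, ht, hst⟩ := hK.map_face g s hs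
  have himg : (g • ·) '' convexHull ℝ (s : Set E) = convexHull ℝ (t : Set E) := by
    rw [← hst]
    ext y
    constructor
    · rintro ⟨x, hx, rfl⟩
      exact ⟨⟨x, hP s hs hx⟩, hx, hcoe _ _⟩
    · rintro ⟨x, hx, rfl⟩
      exact ⟨x, hx, (hcoe _ _).symm⟩
  have himg' : (g⁻¹ • ·) '' convexHull ℝ (t : Set E) = convexHull ℝ (s : Set E) := by
    rw [← himg, Set.image_image]
    simp
  convert! ht
  ext v
  rw [Finset.mem_smul_finset]
  constructor
  · rintro ⟨u, hu, rfl⟩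
    obtain ⟨v, hv, rfl⟩ := hvert g⁻¹ t ht s hs himg' u hu
    rwa [smul_inv_smul]
  · exact hvert g s hs t ht himg v

theorem card_le_of_fixed_by_subgroup [MulAction G P] [MulAction G E]
    (hcoe : ∀ (g : G) (x : P), ((g • x : P) : E) = g • (x : E))
    (hact : IsSimplicialAction G K) (hspace : K.space = P)
    {H : Subgroup G} {d : ℕ}
    (hdim : polyhedralDim ((↑) '' (MulAction.fixedPoints H P) : Set E) ≤ ((d : ℕ∞) : WithBot ℕ∞))
    {s : Finset E} (hs : s ∈ K.faces) (hfix : ∀ g ∈ H, ∀ v ∈ s, g • v = v) : s.card ≤ d + 1 := by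
  have hsub : convexHull ℝ (s : Set E) ⊆ (↑) '' (MulAction.fixedPoints H P) := by
    intro x hx
    refine ⟨⟨x, hspace ▸ SimplicialComplex.convexHull_subset_space hs hx⟩, fun g => ?_, rfl⟩
    obtain ⟨-, A, hA⟩ := hact g s hs
    apply Subtype.ext
    change (((g : G) • (⟨x, _⟩ : P) : P) : E) = x
    rw [hcoe]
    change (g : G) • x = x
    rw [hA x hx]
    exact eqOn_convexHull_of_eqOn (A := A) (B := AffineMap.id ℝ E) (fun v hv => by
      rw [← hA v (subset_convexHull _ _ hv), hfix g g.2 v hv, AffineMap.id_apply]) x hx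
  have hle : (((s.card - 1 : ℕ) : ℕ∞) : WithBot ℕ∞) ≤
      polyhedralDim ((↑) '' (MulAction.fixedPoints H P) : Set E) :=
    le_iSup₂_of_le s ⟨K.nonempty_of_mem_faces hs, K.indep hs, hsub⟩ le_rfl
  have : s.card - 1 ≤ d := by exact_mod_cast hle.trans hdim
  omega

end Invariant

/-! ### Generic equivariant maps -/

section Generic

theorem dense_iInter_of_isOpen_of_finite {X ι : Type*} [TopologicalSpace X] [Finite ι]
    {U : ι → Set X} (ho : ∀ i, IsOpen (U i)) (hd : ∀ i, Dense (U i)) : Dense (⋂ i, U i) := by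
  have := Fintype.ofFinite ι
  have key : ∀ s : Finset ι, IsOpen (⋂ i ∈ s, U i) ∧ Dense (⋂ i ∈ s, U i) := by
    intro s
    induction s using Finset.induction_on with
    | empty => simp
    | insert a s _ ih =>
      rw [Finset.set_biInter_insert]
      exact ⟨(ho a).inter ih.1, (hd a).inter_of_isOpen_left ih.2 (ho a)⟩
  simpa using (key Finset.univ).2

variable {P V : Type*} [TopologicalSpace P] [NormedAddCommGroup V] [NormedSpace ℝ V]

/-- The maps `f` in `M` that send the points `p i` to affinely independent points. This is stated as
linear independence of the vectors `(f (p i), 1)`. -/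
def generalPosition {ι : Type*} (M : Set C(P, V)) (p : ι → P) : Set M :=
  {f | LinearIndependent ℝ fun i => ((f : C(P, V)) (p i), (1 : ℝ))}

theorem isOpen_generalPosition [FiniteDimensional ℝ V] {ι : Type*} [Finite ι] (M : Set C(P, V))
    (p : ι → P) : IsOpen (generalPosition M p) := by
  have hcont : Continuous fun f : M => fun i => ((f : C(P, V)) (p i), (1 : ℝ)) := by
    refine continuous_pi fun i => Continuous.prodMk ?_ continuous_const
    exact (continuous_eval_const (F := C(P, V)) (p i)).comp continuous_subtype_val
  exact (isOpen_setOfPred_linearIndependent (𝕜 := ℝ)).preimage hcont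

theorem dense_generalPosition {ι : Type*} [Finite ι] {M : Set C(P, V)} 
    (hM : ∀ f ∈ M, ∀ h ∈ M, ∀ t : ℝ, (1 - t) • f + t • h ∈ M)
    (p : ι → P) (hne : (generalPosition M p).Nonempty) : Dense (generalPosition M p) := by
  obtain ⟨h, hh⟩ := hne
  intro f
  let γ : ℝ → M := fun t => ⟨(1 - t) • (f : C(P, V)) + t • (h : C(P, V)), hM _ f.2 _ h.2 t⟩
  have hγ : Continuous γ := by
    refine Continuous.subtype_mk ?_ _
    fun_prop
  have hfin := finite_setOf_not_linearIndependent_segment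
    (fun i => ((f : C(P, V)) (p i), (1 : ℝ))) hh
  have hdense := hfin.countable.dense_compl ℝ
  have h0 : γ 0 = f := by
    apply Subtype.ext
    simp [γ]
  have := image_closure_subset_closure_image hγ ⟨0, hdense 0, rfl⟩
  rw [h0] at this
  refine closure_mono ?_ this
  rintro _ ⟨t, ht, rfl⟩
  have ht' := not_not.1 ht
  change LinearIndependent ℝ _
  convert! ht' using 2 with i
  simp [γ]

end Generic

section Fibers

variable {E : Type*} [NormedAddCommGroup E] [NormedSpace ℝ E]
  {V : Type*} [NormedAddCommGroup V] [NormedSpace ℝ V]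

theorem injOn_convexHull_of_linearIndependent {s : Finset E} (A : E →ᵃ[ℝ] V)
    (h : LinearIndependent ℝ fun v : s => (A v, (1 : ℝ))) :
    Set.InjOn A (convexHull ℝ (s : Set E)) := by
  -- `B` sends the images of the vertices back, so it inverts `A` on the simplex.
  obtain ⟨B, hB⟩ := exists_affineMap_apply_eq h fun v => (v : E)
  have hBA : ∀ x ∈ convexHull ℝ (s : Set E), B (A x) = x :=
    eqOn_convexHull_of_eqOn (A := B.comp A) (B := AffineMap.id ℝ E) fun v hv => hB ⟨v, hv⟩
  intro x hx y hy hxy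
  rw [← hBA x hx, hxy, hBA y hy]

end Fibers

end EquivariantPL

end

theorem lemma3p4 {G : Type*} [Group G] [Finite G]
    {E : Type*} [NormedAddCommGroup E] [NormedSpace ℝ E] [FiniteDimensional ℝ E]
    {V : Type*} [NormedAddCommGroup V] [NormedSpace ℝ V] [FiniteDimensional ℝ V]
    (P : Set E) [MulAction G P] (ρ : Representation ℝ G V)
    (hdim : ∀ H : Subgroup G,
      EquivariantPL.polyhedralDim ((↑) '' (MulAction.fixedPoints H P) : Set E) ≤
        ((Module.finrank ℝ (Representation.invariants (ρ.comp H.subtype)) : ℕ∞) : WithBot ℕ∞))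
    (K : Geometry.SimplicialComplex ℝ E)
    (hK : EquivariantPL.IsInvariantTriangulation G K P) :
    ∃ U : Set (EquivariantPL.equivariantMaps ρ P
        (EquivariantPL.secondBarycentricSubdivision K.faces)),
      IsOpen U ∧ Dense U ∧ ∀ f ∈ U, ∀ y : V, ((f : C(P, V)) ⁻¹' {y}).Finite := by
  let _ := EquivariantPL.extendAction G P
  have hcoe : ∀ (g : G) (x : P), ((g • x : P) : E) = g • (x : E) := 
    EquivariantPL.coe_smul_eq_extendAction_smul
  have hact := hK.isSimplicialAction hcoe
  set L := EquivariantPL.subdivision (EquivariantPL.subdivision K) with hL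
  have hLact : EquivariantPL.IsSimplicialAction G L := hact.subdivision.subdivision
  have hLfin : L.faces.Finite :=
    EquivariantPL.subdivision_faces_finite (EquivariantPL.subdivision_faces_finite hK.finite_faces)
  have hLspace : L.space = P := by
    rw [hL, EquivariantPL.subdivision_space, EquivariantPL.subdivision_space, hK.space_eq]
  have hLP : ∀ s ∈ L.faces, ∀ v ∈ s, v ∈ P := fun s hs v hv =>
    hLspace ▸ SimplicialComplex.subset_space hs hv
  have := hLfin.to_subtype
  let p (s : L.faces) (v : (s : Finset E)) : P := ⟨v, hLP s s.2 v v.2⟩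
  let M := EquivariantPL.equivariantMaps ρ P L.faces
  have hM : ∀ f ∈ M, ∀ h ∈ M, ∀ t : ℝ, (1 - t) • f + t • h ∈ M := by
    rintro f ⟨hfρ, hfL⟩ h ⟨hhρ, hhL⟩ t
    refine ⟨fun g x => ?_, fun s hs => ?_⟩
    · simp [hfρ, hhρ]
    · obtain ⟨A, hA⟩ := hfL s hs
      obtain ⟨B, hB⟩ := hhL s hs
      exact ⟨(1 - t) • A + t • B, fun x hx => by simp [hA x hx, hB x hx]⟩
  have hopen := fun s : L.faces => EquivariantPL.isOpen_generalPosition M (p s)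
  refine ⟨⋂ s : L.faces, EquivariantPL.generalPosition M (p s), isOpen_iInter_of_finite hopen,
    EquivariantPL.dense_iInter_of_isOpen_of_finite hopen fun s => ?_, fun f hf y => ?_⟩
  · refine EquivariantPL.dense_generalPosition hM (p s) ?_
    obtain ⟨φ, hφρ, hφ⟩ := EquivariantPL.exists_equivariant_linearIndepOn hact ρ
      (fun H s hs => EquivariantPL.card_le_of_fixed_by_subgroup hcoe hLact hLspace
        (hdim H) hs) s.2
    obtain ⟨h, hcont, hhρ, hhL, hhφ⟩ :=
      EquivariantPL.exists_equivariant_extension hLfin hLact ρ hφρ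
    rw [hLspace] at hcont hhρ
    refine ⟨⟨⟨P.domRestrict h, hcont.domRestrict⟩, fun g x => ?_, fun s hs => ?_⟩, ?_⟩
    · change h ((g • x : P) : E) = ρ g (h x)
      rw [hcoe, hhρ g x x.2]
    · obtain ⟨A, hA⟩ := hhL s hs
      exact ⟨A, fun x hx => hA x hx⟩
    · have heq : (fun v : (s : Finset E) => (φ v, (1 : ℝ))) = fun v : (s : Finset E) => (h v, 1) :=
        funext fun v => by rw [hhφ s s.2 v v.2]
      change LinearIndependent ℝ fun v : (s : Finset E) => (h v, (1 : ℝ))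
      rw [← heq]
      exact hφ
  · have hcover : (f : C(P, V)) ⁻¹' {y} ⊆ ⋃ s : L.faces,
        {x : P | (x : E) ∈ convexHull ℝ ((s : Finset E) : Set E) ∧ (f : C(P, V)) x = y} := by
      intro x hx
      obtain ⟨s, hs, hxs⟩ := SimplicialComplex.mem_space_iff.1 (hLspace.ge x.2)
      exact Set.mem_iUnion.2 ⟨⟨s, hs⟩, hxs, hx⟩
    refine (Set.finite_iUnion fun s => Set.Subsingleton.finite ?_).subset hcover
    rintro x ⟨hx, hxy⟩ x' ⟨hx', hxy'⟩
    obtain ⟨A, hA⟩ := f.2.2 s s.2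
    have hli := Set.mem_iInter.1 hf s
    refine Subtype.ext (EquivariantPL.injOn_convexHull_of_linearIndependent (s := s) A ?_ hx hx' ?_)
    · have heq : (fun v => ((f : C(P, V)) (p s v), (1 : ℝ))) =
          fun v : (s : Finset E) => (A v, 1) :=
        funext fun v => by rw [hA (p s v) (subset_convexHull _ _ v.2)]
      exact heq ▸ hli
    · rw [← hA x hx, ← hA x' hx', hxy, hxy']
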